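/- Let $k$ be a field and let $r,s\ge 3$. Let $I$ be a proper monomial ideal of $A=k[x_1,\dots,x_r]$ such that $x_3,\dots,x_r\in\sqrt I$, and let $J$ be a proper monomial ideal of $B=k[y_1,\dots,y_s]$ such that $y_3,\dots,y_s\in\sqrt J$. Let $R=k[x_1,\dots,x_r,y_1,\dots,y_s]$, and write $I$ and $J$ also for the ideals they generate in $R$. Let $n>0$ be an integer such that $\operatorname{depth} A/I^n>0$ or $\operatorname{depth} B/J^n>0$. Then $$\operatorname{depth} R/\bigl((IJ)^n,\,x_1-y_1,\,x_2-y_2\bigr)=\operatorname{depth} A/I^n+\operatorname{depth} B/J^n-1.$$ Here the depth of a nonzero finitely generated graded module $M$ over a polynomial ring over $k$ is the supremum of the lengths of the $M$-regular sequences contained in the ideal generated by the variables. -/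

import Mathlib

/-- An ideal of a polynomial ring is a monomial ideal if it is generated by a set of monomials. -/
def IsMonomialIdeal {σ k : Type*} [Field k] (I : Ideal (MvPolynomial σ k)) : Prop :=
  ∃ S : Set (σ →₀ ℕ), I = Ideal.span ((fun a => MvPolynomial.monomial a (1 : k)) '' S)

/-- The depth of a module `M` over the polynomial ring `k[x_i : i ∈ σ]` (with respect to the
graded maximal ideal generated by the variables): the supremum of the lengths of the `M`-regular
sequences contained in that ideal. It is only meant for modules with `𝔪 M ≠ M`, such as nonzero
finitely generated graded modules; the zero module has no regular sequences and gets the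
value `0`. -/
noncomputable def polyDepth (σ k : Type*) [Field k] (M : Type*) [AddCommGroup M]
    [Module (MvPolynomial σ k) M] : ℕ∞ :=
  ⨆ (rs : List (MvPolynomial σ k))
    (_ : (∀ f ∈ rs, f ∈ MvPolynomial.idealOfVars σ k) ∧ RingTheory.Sequence.IsRegular M rs),
    (rs.length : ℕ∞)

-- Replace $I,J$ by $I^n,J^n$: they stay proper and monomial with the same radicals, and they are
-- nonzero since they contain powers of the third variables. Put $a=\operatorname{depth}A/I$ and
-- $b=\operatorname{depth}B/J$.
--
-- In disjoint variables $IJ=I\cap J$, so there is an exact sequence $0\to R/IJ\to R/I\oplus R/J\to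
-- R/(I+J)\to 0$. The last term is $A/I\otimes_k B/J$, of depth $a+b$ (`polyDepth_extend`). The
-- middle has larger depth: $\operatorname{depth}R/I\ge a+s$ with $s>b$ because $J\ne 0$, and
-- symmetrically for $R/J$. The depth lemma gives $\operatorname{depth}R/IJ=a+b+1$
-- (`polyDepth_extend_inf`).
--
-- It remains to see that the two linear forms cost exactly 2. The ideal they generate is also
-- $(z,w)$ with $z=x_1+x_2-y_1-y_2$ and $w=x_2-y_2$, and $z,w$ is a regular sequence on $R/IJ$. The
-- crux is that $z$ is regular modulo $I+J$ (`regular_diagonal_sup`), which is where positive depth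
-- enters. The form $x_1-y_1$ would not do: $x_1$ and $y_1$ can both be zero divisors although the
-- depths are positive.

universe u

/-! ### Depth through Ext, and the depth lemma for short exact sequences. -/

section Depth

open CategoryTheory Abelian RingTheory.Sequence

variable {σ : Type} {k : Type u} [Field k]

/-- The condition `𝔪 M ≠ M` descends along surjections: it holds for `M` if it does for an image. -/
lemma ideal_smul_top_ne_top_of_surjective {R M N : Type*} [CommRing R] [AddCommGroup M]
    [AddCommGroup N] [Module R M] [Module R N] {𝔪 : Ideal R} (g : M →ₗ[R] N)
    (hg : Function.Surjective g) (hN : 𝔪 • (⊤ : Submodule R N) ≠ ⊤) :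
    𝔪 • (⊤ : Submodule R M) ≠ ⊤ := by
  intro h
  apply hN
  have := congrArg (Submodule.map g) h
  rwa [Submodule.map_smul'', Submodule.map_top, LinearMap.range_eq_top.mpr hg] at this

lemma ideal_smul_top_quotient_ne_top {R : Type*} [CommRing R] {𝔪 L : Ideal R} (h𝔪 : 𝔪 ≠ ⊤)
    (hL : L ≤ 𝔪) : 𝔪 • (⊤ : Submodule R (R ⧸ L)) ≠ ⊤ := by
  refine ideal_smul_top_ne_top_of_surjective (Submodule.factor hL)
    (Submodule.factor_surjective hL) ?_
  intro h
  have h1 : (Submodule.Quotient.mk (1 : R) : R ⧸ 𝔪) ∈ 𝔪 • (⊤ : Submodule R (R ⧸ 𝔪)) := by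
    rw [h]; trivial
  have h2 : 𝔪 • (⊤ : Submodule R (R ⧸ 𝔪)) ≤ ⊥ := by
    rw [Submodule.smul_le]
    rintro r hr n -
    obtain ⟨n, rfl⟩ := Submodule.Quotient.mk_surjective _ n
    rw [← Submodule.Quotient.mk_smul, Submodule.mem_bot, Submodule.Quotient.mk_eq_zero]
    exact Ideal.mul_mem_right _ _ hr
  have h3 := h2 h1
  rw [Submodule.mem_bot, Submodule.Quotient.mk_eq_zero] at h3
  exact h𝔪 ((Ideal.eq_top_iff_one _).mpr h3)

lemma idealOfVars_ne_top : MvPolynomial.idealOfVars σ k ≠ ⊤ := by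
  intro h
  have h1 : (MvPolynomial.C 1 : MvPolynomial σ k) ∈ MvPolynomial.idealOfVars σ k ^ 1 := by
    rw [pow_one, h]; trivial
  rw [MvPolynomial.C_mem_pow_idealOfVars_iff] at h1
  simp at h1

/-- The residue field at the origin, as a module over the polynomial ring. -/
noncomputable abbrev residueModule (σ : Type) (k : Type u) [Field k] :
    ModuleCat.{u} (MvPolynomial σ k) :=
  ModuleCat.of _ (Shrink.{u} (MvPolynomial σ k ⧸ MvPolynomial.idealOfVars σ k))

/-- Rees's theorem. Phrasing it through lower bounds by natural numbers avoids assuming that the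
supremum is finite or attained. -/
lemma le_polyDepth_iff_ext [Finite σ] (M : ModuleCat.{u} (MvPolynomial σ k))
    [Module.Finite (MvPolynomial σ k) M]
    (hM : MvPolynomial.idealOfVars σ k • (⊤ : Submodule (MvPolynomial σ k) M) ≠ ⊤) (n : ℕ) :
    (n : ℕ∞) ≤ polyDepth σ k M ↔ ∀ i < n, Subsingleton (Ext (residueModule σ k) M i) := by
  have key := fun m => (ModuleCat.exists_isRegular_tfae (MvPolynomial.idealOfVars σ k) m M
    hM.lt_top).out 1 3
  constructor
  · intro h i hi
    -- For each single `i`, a regular sequence longer than `i` suffices; its length may depend on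
    -- `i`.
    obtain ⟨rs, h1, h2⟩ : ∃ rs : List (MvPolynomial σ k), ((∀ f ∈ rs,
        f ∈ MvPolynomial.idealOfVars σ k) ∧ IsRegular M rs) ∧ (i : ℕ∞) < rs.length := by
      have h' : (i : ℕ∞) < polyDepth σ k M := lt_of_lt_of_le (by exact_mod_cast hi) h
      simpa [polyDepth, lt_iSup_iff] using h'
    exact (key rs.length).2 ⟨rs, rfl, h1⟩ i (by exact_mod_cast h2)
  · intro h
    obtain ⟨rs, rfl, h1⟩ := (key n).1 h
    exact le_iSup₂_of_le rs h1 le_rfl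

lemma exists_isRegular_of_le_polyDepth [Finite σ] {M : Type u} [AddCommGroup M]
    [Module (MvPolynomial σ k) M] [Module.Finite (MvPolynomial σ k) M]
    (hM : MvPolynomial.idealOfVars σ k • (⊤ : Submodule (MvPolynomial σ k) M) ≠ ⊤) {n : ℕ}
    (hn : (n : ℕ∞) ≤ polyDepth σ k M) :
    ∃ rs : List (MvPolynomial σ k), rs.length = n ∧
      (∀ f ∈ rs, f ∈ MvPolynomial.idealOfVars σ k) ∧ IsRegular M rs :=
  ((ModuleCat.exists_isRegular_tfae (MvPolynomial.idealOfVars σ k) n (ModuleCat.of _ M)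
    hM.lt_top).out 1 3).1 ((le_polyDepth_iff_ext (ModuleCat.of _ M) hM n).1 hn)

lemma polyDepth_congr {M N : Type*} [AddCommGroup M] [AddCommGroup N]
    [Module (MvPolynomial σ k) M] [Module (MvPolynomial σ k) N]
    (e : M ≃ₗ[MvPolynomial σ k] N) : polyDepth σ k M = polyDepth σ k N := by
  unfold polyDepth
  simp only [e.isRegular_congr]

variable [Finite σ] {M₁ M₂ M₃ : Type u} [AddCommGroup M₁] [AddCommGroup M₂] [AddCommGroup M₃]
  [Module (MvPolynomial σ k) M₁] [Module (MvPolynomial σ k) M₂] [Module (MvPolynomial σ k) M₃]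
  [Module.Finite (MvPolynomial σ k) M₁] [Module.Finite (MvPolynomial σ k) M₂]
  [Module.Finite (MvPolynomial σ k) M₃]
  {f : M₁ →ₗ[MvPolynomial σ k] M₂} {g : M₂ →ₗ[MvPolynomial σ k] M₃}

lemma shortExact_of_exact {R : Type u} [CommRing R] {M₁ M₂ M₃ : Type u} [AddCommGroup M₁]
    [AddCommGroup M₂] [AddCommGroup M₃] [Module R M₁] [Module R M₂] [Module R M₃]
    {f : M₁ →ₗ[R] M₂} {g : M₂ →ₗ[R] M₃} (hf : Function.Injective f)
    (hfg : Function.Exact f g) (hg : Function.Surjective g) :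
    (ModuleCat.shortComplexOfCompEqZero f g hfg.linearMap_comp_eq_zero).ShortExact where
  exact := ModuleCat.shortComplex_exact _ hfg
  mono_f := (ModuleCat.mono_iff_injective _).mpr hf
  epi_g := (ModuleCat.epi_iff_surjective _).mpr hg

/-- The depth lemma, bounding the middle term. -/
lemma le_polyDepth_middle (hf : Function.Injective f) (hfg : Function.Exact f g)
    (hg : Function.Surjective g)
    (h₁ : MvPolynomial.idealOfVars σ k • (⊤ : Submodule (MvPolynomial σ k) M₁) ≠ ⊤)
    (h₂ : MvPolynomial.idealOfVars σ k • (⊤ : Submodule (MvPolynomial σ k) M₂) ≠ ⊤)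
    (h₃ : MvPolynomial.idealOfVars σ k • (⊤ : Submodule (MvPolynomial σ k) M₃) ≠ ⊤)
    {n : ℕ} (hn₁ : (n : ℕ∞) ≤ polyDepth σ k M₁) (hn₃ : (n : ℕ∞) ≤ polyDepth σ k M₃) :
    (n : ℕ∞) ≤ polyDepth σ k M₂ := by
  have hS := shortExact_of_exact hf hfg hg
  rw [le_polyDepth_iff_ext (ModuleCat.of _ _) (by assumption)] at *
  intro i hi
  have a := hn₁ i hi
  have b := hn₃ i hi
  refine subsingleton_of_forall_eq 0 fun x => ?_
  obtain ⟨y, rfl⟩ := Ext.covariant_sequence_exact₂ (residueModule σ k) hS x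
    (Subsingleton.elim (α := Ext _ (ModuleCat.of (MvPolynomial σ k) M₃) i) _ _)
  rw [Subsingleton.elim (α := Ext _ (ModuleCat.of (MvPolynomial σ k) M₁) i) y 0, Ext.zero_comp]

/-- The depth lemma, bounding the quotient. -/
lemma le_polyDepth_right (hf : Function.Injective f) (hfg : Function.Exact f g)
    (hg : Function.Surjective g)
    (h₁ : MvPolynomial.idealOfVars σ k • (⊤ : Submodule (MvPolynomial σ k) M₁) ≠ ⊤)
    (h₂ : MvPolynomial.idealOfVars σ k • (⊤ : Submodule (MvPolynomial σ k) M₂) ≠ ⊤)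
    (h₃ : MvPolynomial.idealOfVars σ k • (⊤ : Submodule (MvPolynomial σ k) M₃) ≠ ⊤)
    {n : ℕ} (hn₁ : ((n + 1 : ℕ) : ℕ∞) ≤ polyDepth σ k M₁)
    (hn₂ : (n : ℕ∞) ≤ polyDepth σ k M₂) :
    (n : ℕ∞) ≤ polyDepth σ k M₃ := by
  have hS := shortExact_of_exact hf hfg hg
  rw [le_polyDepth_iff_ext (ModuleCat.of _ _) (by assumption)] at *
  intro i hi
  have a := hn₁ (i + 1) (by omega)
  have b := hn₂ i hi
  refine subsingleton_of_forall_eq 0 fun x => ?_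
  obtain ⟨y, rfl⟩ := Ext.covariant_sequence_exact₃ (residueModule σ k) hS x rfl
    (Subsingleton.elim (α := Ext _ (ModuleCat.of (MvPolynomial σ k) M₁) (i + 1)) _ _)
  rw [Subsingleton.elim (α := Ext _ (ModuleCat.of (MvPolynomial σ k) M₂) i) y 0, Ext.zero_comp]

/-- The depth lemma, bounding the submodule. -/
lemma le_polyDepth_left (hf : Function.Injective f) (hfg : Function.Exact f g)
    (hg : Function.Surjective g)
    (h₁ : MvPolynomial.idealOfVars σ k • (⊤ : Submodule (MvPolynomial σ k) M₁) ≠ ⊤)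
    (h₂ : MvPolynomial.idealOfVars σ k • (⊤ : Submodule (MvPolynomial σ k) M₂) ≠ ⊤)
    (h₃ : MvPolynomial.idealOfVars σ k • (⊤ : Submodule (MvPolynomial σ k) M₃) ≠ ⊤)
    {n : ℕ} (hn₂ : ((n + 1 : ℕ) : ℕ∞) ≤ polyDepth σ k M₂)
    (hn₃ : (n : ℕ∞) ≤ polyDepth σ k M₃) :
    ((n + 1 : ℕ) : ℕ∞) ≤ polyDepth σ k M₁ := by
  have hS := shortExact_of_exact hf hfg hg
  rw [le_polyDepth_iff_ext (ModuleCat.of _ _) (by assumption)] at *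
  intro i hi
  have b := hn₂ i hi
  refine subsingleton_of_forall_eq 0 fun x => ?_
  -- In degree 0 there is no preceding Ext of `M₃`; left exactness of Hom takes its place.
  rcases i with _ | i
  · exact Ext.postcomp_mk₀_injective_of_mono (residueModule σ k) (hf := hS.mono_f) _
      (Subsingleton.elim (α := Ext _ (ModuleCat.of (MvPolynomial σ k) M₂) 0) _ _)
  have a := hn₃ i (by omega)
  obtain ⟨y, rfl⟩ := Ext.covariant_sequence_exact₁ (residueModule σ k) hS x
    (Subsingleton.elim (α := Ext _ (ModuleCat.of (MvPolynomial σ k) M₂) (i + 1)) _ _) rfl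
  rw [Subsingleton.elim (α := Ext _ (ModuleCat.of (MvPolynomial σ k) M₃) i) y 0, Ext.zero_comp]

end Depth

/-! ### Depth of cyclic modules: regular elements, socles, dimension bounds. -/

section Quotient

open RingTheory.Sequence Pointwise

variable {σ : Type} {k : Type u} [Field k]

lemma isSMulRegular_quotient_iff {R : Type*} [CommRing R] {L : Ideal R} {x : R} :
    IsSMulRegular (R ⧸ L) x ↔ ∀ f, x * f ∈ L → f ∈ L := by
  simpa using isSMulRegular_quotient_iff_mem_of_smul_mem (M := R) (N := L) (r := x)

/-- The quotient of `R ⧸ L` by an element, as a quotient of `R`. -/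
noncomputable def quotSMulTopQuotientEquiv {R : Type*} [CommRing R] (L : Ideal R) (x : R) :
    QuotSMulTop x (R ⧸ L) ≃ₗ[R] R ⧸ (L ⊔ Ideal.span {x}) :=
  (Submodule.quotEquivOfEq _ (Submodule.map L.mkQ (L ⊔ Ideal.span {x})) (by
    rw [Submodule.map_sup, Submodule.mkQ_map_self, bot_sup_eq]
    ext y
    obtain ⟨y, rfl⟩ := Submodule.Quotient.mk_surjective _ y
    simp only [Submodule.mem_smul_pointwise_iff_exists, Submodule.mem_map,
      Ideal.mem_span_singleton']
    constructor
    · rintro ⟨b, -, hb⟩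
      obtain ⟨b, rfl⟩ := Submodule.Quotient.mk_surjective _ b
      exact ⟨b * x, ⟨b, rfl⟩, by rw [← hb, mul_comm]; rfl⟩
    · rintro ⟨_, ⟨b, rfl⟩, hb⟩
      exact ⟨Submodule.Quotient.mk b, trivial, by rw [← hb, mul_comm]; rfl⟩)).trans
  (Submodule.quotientQuotientEquivQuotient _ _ le_sup_left)

/-- Depth drops by exactly one modulo a regular element. -/
lemma polyDepth_quotient_sup_span_singleton [Finite σ] {L : Ideal (MvPolynomial σ k)}
    {x : MvPolynomial σ k} (hL : L ≤ MvPolynomial.idealOfVars σ k)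
    (hx : x ∈ MvPolynomial.idealOfVars σ k) (hreg : ∀ f, x * f ∈ L → f ∈ L) :
    polyDepth σ k (MvPolynomial σ k ⧸ L) =
      polyDepth σ k (MvPolynomial σ k ⧸ (L ⊔ Ideal.span {x})) + 1 := by
  have hL' : L ⊔ Ideal.span {x} ≤ MvPolynomial.idealOfVars σ k :=
    sup_le hL ((Ideal.span_singleton_le_iff_mem _).mpr hx)
  have h1 := ideal_smul_top_quotient_ne_top (idealOfVars_ne_top (σ := σ) (k := k)) hL
  have h2 := ideal_smul_top_quotient_ne_top (idealOfVars_ne_top (σ := σ) (k := k)) hL'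
  have hr : IsSMulRegular (MvPolynomial σ k ⧸ L) x := isSMulRegular_quotient_iff.mpr hreg
  rw [← polyDepth_congr (quotSMulTopQuotientEquiv L x)]
  have h3 : MvPolynomial.idealOfVars σ k •
      (⊤ : Submodule _ (QuotSMulTop x (MvPolynomial σ k ⧸ L))) ≠ ⊤ :=
    ideal_smul_top_ne_top_of_surjective (quotSMulTopQuotientEquiv L x).toLinearMap
      (quotSMulTopQuotientEquiv L x).surjective h2
  apply ENat.eq_of_forall_natCast_le_iff
  rintro (_ | n)
  · simp
  rw [Nat.cast_succ, ENat.add_le_add_iff_right ENat.one_ne_top, ← Nat.cast_succ]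
  constructor
  · intro h
    -- The depth lemma for multiplication by `x` on `R/L` and its cokernel.
    exact le_polyDepth_right (f := LinearMap.lsmul _ _ x) hr
      (LinearMap.exact_lsmul_mkQ_smul_top _ x) (Submodule.mkQ_surjective _) h1 h1 h3 h
      (le_trans (by exact_mod_cast Nat.le_succ n) h)
  · intro h
    obtain ⟨rs, rfl, hrs, hreg'⟩ := exists_isRegular_of_le_polyDepth h3 h
    exact le_iSup₂_of_le (x :: rs) ⟨by simpa [hx] using hrs, .cons hr hreg'⟩ (by simp)


/-- The class of `f` is nonzero and killed by every element of the maximal ideal, so none of these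
is regular. -/
lemma polyDepth_quotient_eq_zero_of_socle {L : Ideal (MvPolynomial σ k)} {f : MvPolynomial σ k}
    (hf : f ∉ L) (h : ∀ i, MvPolynomial.X i * f ∈ L) :
    polyDepth σ k (MvPolynomial σ k ⧸ L) = 0 := by
  have h' : ∀ x ∈ MvPolynomial.idealOfVars σ k, x * f ∈ L := by
    have : MvPolynomial.idealOfVars σ k ≤ Submodule.colon L {f} := by
      rw [MvPolynomial.idealOfVars, Ideal.span_le]
      rintro _ ⟨i, rfl⟩
      simpa [Submodule.mem_colon_singleton] using h i
    intro x hx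
    simpa [Submodule.mem_colon_singleton] using this hx
  refine le_antisymm (iSup₂_le ?_) zero_le
  rintro (_ | ⟨x, rs⟩) ⟨hm, hr⟩
  · simp
  · rw [isRegular_cons_iff] at hr
    exact absurd (isSMulRegular_quotient_iff.mp hr.1 f (h' x (hm x (by simp)))) hf

lemma exists_regular_of_polyDepth_ne_zero {L : Ideal (MvPolynomial σ k)}
    (h : polyDepth σ k (MvPolynomial σ k ⧸ L) ≠ 0) :
    ∃ x ∈ MvPolynomial.idealOfVars σ k, ∀ f, x * f ∈ L → f ∈ L := by
  rw [← pos_iff_ne_zero, polyDepth, lt_iSup_iff] at h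
  obtain ⟨rs, h⟩ := h
  rw [lt_iSup_iff] at h
  obtain ⟨⟨hm, hr⟩, hpos⟩ := h
  rcases rs with _ | ⟨x, rs⟩
  · simp at hpos
  · rw [isRegular_cons_iff] at hr
    exact ⟨x, hm x (by simp), isSMulRegular_quotient_iff.mp hr.1⟩

/-- With no regular element in the maximal ideal there is a nonzero map from the residue field to
the quotient; a lift of the image of 1 is the required `f`. -/
lemma exists_socle_of_polyDepth_eq_zero [Finite σ] {L : Ideal (MvPolynomial σ k)}
    (hL : L ≤ MvPolynomial.idealOfVars σ k)
    (h : polyDepth σ k (MvPolynomial σ k ⧸ L) = 0) :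
    ∃ f ∉ L, ∀ i, MvPolynomial.X i * f ∈ L := by
  have hns : ¬ Subsingleton ((MvPolynomial σ k ⧸ MvPolynomial.idealOfVars σ k)
      →ₗ[MvPolynomial σ k] (MvPolynomial σ k ⧸ L)) := by
    rw [IsSMulRegular.subsingleton_linearMap_iff, Ideal.annihilator_quotient]
    rintro ⟨x, hx, hr⟩
    rw [polyDepth_quotient_sup_span_singleton hL hx (isSMulRegular_quotient_iff.mp hr)] at h
    simp at h
  rw [not_subsingleton_iff_nontrivial] at hns
  obtain ⟨φ, hφ⟩ := exists_ne (0 : (MvPolynomial σ k ⧸ MvPolynomial.idealOfVars σ k)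
      →ₗ[MvPolynomial σ k] (MvPolynomial σ k ⧸ L))
  obtain ⟨f, hf⟩ := Submodule.Quotient.mk_surjective _ (φ (Submodule.Quotient.mk 1))
  refine ⟨f, fun hfL => hφ ?_, fun i => ?_⟩
  · have h0 : φ (Submodule.Quotient.mk 1) = 0 := by
      rw [← hf, Submodule.Quotient.mk_eq_zero]; exact hfL
    ext
    simpa using h0
  · rw [← Submodule.Quotient.mk_eq_zero (p := L), ← smul_eq_mul, Submodule.Quotient.mk_smul, hf,
      ← map_smul, ← Submodule.Quotient.mk_smul, smul_eq_mul, mul_one]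
    rw [(Submodule.Quotient.mk_eq_zero (p := MvPolynomial.idealOfVars σ k)).mpr, map_zero]
    exact Ideal.subset_span ⟨i, rfl⟩

/-- A regular element avoids the minimal primes of the support, so killing it lowers the dimension
by at least one. -/
lemma length_le_supportDim_of_isRegular {R : Type*} [CommRing R] [IsNoetherianRing R]
    {M : Type*} [AddCommGroup M] [Module R M] [Module.Finite R M] {rs : List R}
    (h : IsRegular M rs) : (rs.length : WithBot ℕ∞) ≤ Module.supportDim R M := by
  induction rs generalizing M with
  | nil =>
    have := h.nontrivial
    have := (Module.nonempty_support_of_nontrivial (R := R) (M := M)).to_subtype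
    simpa [Module.supportDim] using Order.krullDim_nonneg (α := Module.support R M)
  | cons x rs ih =>
    rw [isRegular_cons_iff] at h
    calc ((x :: rs).length : WithBot ℕ∞) = rs.length + 1 := by simp
      _ ≤ Module.supportDim R (QuotSMulTop x M) + 1 := by gcongr; exact ih h.2
      _ ≤ _ := Module.supportDim_quotSMulTop_succ_le_of_notMem_minimalPrimes
        fun _ => h.1.notMem_of_mem_minimalPrimes

/-- A nonzero ideal has positive codimension, which bounds the depth of the quotient. -/
lemma exists_polyDepth_quotient_eq_lt_card [Finite σ] {L : Ideal (MvPolynomial σ k)}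
    (hL : L ≤ MvPolynomial.idealOfVars σ k) {x : MvPolynomial σ k} (hx : x ≠ 0) (hxL : x ∈ L) :
    ∃ d : ℕ, polyDepth σ k (MvPolynomial σ k ⧸ L) = d ∧ d < Nat.card σ := by
  have hdim : ringKrullDim (MvPolynomial σ k ⧸ L) + 1 ≤ (Nat.card σ : WithBot ℕ∞) := by
    calc ringKrullDim (MvPolynomial σ k ⧸ L) + 1
        ≤ ringKrullDim (MvPolynomial σ k ⧸ Ideal.span {x}) + 1 := by
          gcongr
          exact ringKrullDim_le_of_surjective (Ideal.Quotient.factor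
            ((Ideal.span_singleton_le_iff_mem L).mpr hxL)) (Ideal.Quotient.factor_surjective _)
      _ ≤ ringKrullDim (MvPolynomial σ k) :=
          ringKrullDim_quotient_succ_le_of_nonZeroDivisor (mem_nonZeroDivisors_of_ne_zero hx)
      _ = _ := by
          rw [MvPolynomial.ringKrullDim_of_isNoetherianRing, ringKrullDim_eq_zero_of_field, zero_add]
  have key : ∀ n : ℕ, (n : ℕ∞) ≤ polyDepth σ k (MvPolynomial σ k ⧸ L) → n < Nat.card σ := by
    intro n hn
    obtain ⟨rs, rfl, -, hr⟩ := exists_isRegular_of_le_polyDepth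
      (ideal_smul_top_quotient_ne_top idealOfVars_ne_top hL) hn
    have h1 := length_le_supportDim_of_isRegular hr
    rw [Module.supportDim_quotient_eq_ringKrullDim] at h1
    have h2 : (rs.length : WithBot ℕ∞) + 1 ≤ (Nat.card σ : WithBot ℕ∞) :=
      le_trans (by gcongr) hdim
    exact_mod_cast h2
  cases hd : polyDepth σ k (MvPolynomial σ k ⧸ L) with
  | top => exact absurd (key (Nat.card σ) (by rw [hd]; exact le_top)) (lt_irrefl _)
  | coe d => exact ⟨d, rfl, key d hd.ge⟩

/-- The depth lemma for `0 → P/(I ∩ J) → P/I × P/J → P/(I + J) → 0`. -/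
lemma polyDepth_quotient_inf [Finite σ] {I J : Ideal (MvPolynomial σ k)}
    (hI : I ≤ MvPolynomial.idealOfVars σ k) (hJ : J ≤ MvPolynomial.idealOfVars σ k) {q : ℕ}
    (hq : polyDepth σ k (MvPolynomial σ k ⧸ (I ⊔ J)) = q)
    (hqI : ((q + 1 : ℕ) : ℕ∞) ≤ polyDepth σ k (MvPolynomial σ k ⧸ I))
    (hqJ : ((q + 1 : ℕ) : ℕ∞) ≤ polyDepth σ k (MvPolynomial σ k ⧸ J)) :
    polyDepth σ k (MvPolynomial σ k ⧸ (I ⊓ J)) = q + 1 := by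
  have hm := idealOfVars_ne_top (σ := σ) (k := k)
  have nI := ideal_smul_top_quotient_ne_top hm hI
  have nJ := ideal_smul_top_quotient_ne_top hm hJ
  have nS := ideal_smul_top_quotient_ne_top hm (sup_le hI hJ)
  have nK := ideal_smul_top_quotient_ne_top hm (inf_le_left.trans hI : I ⊓ J ≤ _)
  have nP := ideal_smul_top_ne_top_of_surjective (LinearMap.fst (MvPolynomial σ k)
    (MvPolynomial σ k ⧸ I) (MvPolynomial σ k ⧸ J)) LinearMap.fst_surjective nI
  have hP : ((q + 1 : ℕ) : ℕ∞) ≤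
      polyDepth σ k ((MvPolynomial σ k ⧸ I) × (MvPolynomial σ k ⧸ J)) :=
    le_polyDepth_middle LinearMap.inl_injective Function.Exact.inl_snd LinearMap.snd_surjective
      nI nP nJ hqI hqJ
  let f : (MvPolynomial σ k ⧸ (I ⊓ J)) →ₗ[MvPolynomial σ k]
      (MvPolynomial σ k ⧸ I) × (MvPolynomial σ k ⧸ J) :=
    (Submodule.factor inf_le_left).prod (Submodule.factor inf_le_right)
  let g : (MvPolynomial σ k ⧸ I) × (MvPolynomial σ k ⧸ J) →ₗ[MvPolynomial σ k]
      (MvPolynomial σ k ⧸ (I ⊔ J)) :=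
    -- The difference map: its kernel consists of the pairs that agree modulo the sum.
    (Submodule.factor le_sup_left).coprod (-Submodule.factor le_sup_right)
  have hf : Function.Injective f := by
    rw [← LinearMap.ker_eq_bot, LinearMap.ker_eq_bot']
    intro a ha
    obtain ⟨a, rfl⟩ := Submodule.Quotient.mk_surjective _ a
    have h1 := congrArg Prod.fst ha
    have h2 := congrArg Prod.snd ha
    change (Submodule.Quotient.mk a : MvPolynomial σ k ⧸ I) = 0 at h1
    change (Submodule.Quotient.mk a : MvPolynomial σ k ⧸ J) = 0 at h2
    rw [Submodule.Quotient.mk_eq_zero] at *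
    exact ⟨h1, h2⟩
  have hg : Function.Surjective g := by
    intro a
    obtain ⟨a, rfl⟩ := Submodule.Quotient.mk_surjective _ a
    exact ⟨(Submodule.Quotient.mk a, 0), by simp [g]⟩
  have hfg : Function.Exact f g := by
    rintro ⟨a, b⟩
    obtain ⟨a, rfl⟩ := Submodule.Quotient.mk_surjective _ a
    obtain ⟨b, rfl⟩ := Submodule.Quotient.mk_surjective _ b
    have hgab : g (Submodule.Quotient.mk a, Submodule.Quotient.mk b) =
        Submodule.Quotient.mk (a - b) := by
      simp [g, sub_eq_add_neg]
    rw [hgab, Submodule.Quotient.mk_eq_zero]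
    constructor
    · intro h
      obtain ⟨i, hi, j, hj, hij⟩ := Submodule.mem_sup.mp h
      refine ⟨Submodule.Quotient.mk (a - i), Prod.ext ?_ ?_⟩
      · change (Submodule.Quotient.mk (a - i) : MvPolynomial σ k ⧸ I) = Submodule.Quotient.mk a
        rw [Submodule.Quotient.eq]
        simpa using hi
      · change (Submodule.Quotient.mk (a - i) : MvPolynomial σ k ⧸ J) = Submodule.Quotient.mk b
        rw [Submodule.Quotient.eq]
        have : a - i - b = j := by linear_combination -hij
        rwa [this]
    · rintro ⟨c, hc⟩
      obtain ⟨c, rfl⟩ := Submodule.Quotient.mk_surjective _ c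
      have h1 : (Submodule.Quotient.mk c : MvPolynomial σ k ⧸ I) = Submodule.Quotient.mk a :=
        congrArg Prod.fst hc
      have h2 : (Submodule.Quotient.mk c : MvPolynomial σ k ⧸ J) = Submodule.Quotient.mk b :=
        congrArg Prod.snd hc
      rw [Submodule.Quotient.eq] at h1 h2
      have : a - b = (c - b) - (c - a) := by ring
      rw [this]
      exact Submodule.sub_mem _ (Ideal.mem_sup_right h2) (Ideal.mem_sup_left h1)
  refine le_antisymm ?_ ?_
  -- Depth at least `q + 2` on the left, with `q + 1` in the middle, would force depth at least `q +
  -- 1` for the quotient by the sum.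
  · by_contra! hlt
    have h2 : ((q + 1 + 1 : ℕ) : ℕ∞) ≤ polyDepth σ k (MvPolynomial σ k ⧸ (I ⊓ J)) := by
      have := Order.add_one_le_of_lt hlt
      exact_mod_cast this
    have h3 := le_polyDepth_right hf hfg hg nK nP nS h2 hP
    rw [hq] at h3
    exact absurd (by exact_mod_cast h3) (Nat.not_succ_le_self q)
  · exact_mod_cast le_polyDepth_left hf hfg hg nK nP nS hP hq.ge

/-- The variables form a regular sequence; each one killed lowers the depth by exactly one. -/
lemma card_le_polyDepth_quotient_bot [Finite σ] :
    (Nat.card σ : ℕ∞) ≤ polyDepth σ k (MvPolynomial σ k ⧸ (⊥ : Ideal (MvPolynomial σ k))) := by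
  classical
  have := Fintype.ofFinite σ
  have key : ∀ T : Finset σ, polyDepth σ k (MvPolynomial σ k ⧸ (⊥ : Ideal (MvPolynomial σ k))) =
      polyDepth σ k (MvPolynomial σ k ⧸ Ideal.span (MvPolynomial.X '' (T : Set σ) :
        Set (MvPolynomial σ k))) + T.card := by
    intro T
    induction T using Finset.induction_on with
    | empty => rw [Finset.coe_empty, Set.image_empty, Ideal.span_empty]; simp
    | insert i T hi ih =>
      rw [ih, polyDepth_quotient_sup_span_singleton (x := MvPolynomial.X i),
        Finset.coe_insert, Set.image_insert_eq, Ideal.span_insert, sup_comm,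
        Finset.card_insert_of_notMem hi, Nat.cast_succ, add_assoc, add_comm (1 : ℕ∞)]
      · exact Ideal.span_mono (Set.image_subset_range _ _)
      · exact Ideal.subset_span ⟨i, rfl⟩
      · intro f hf
        rw [MvPolynomial.mem_ideal_span_X_image] at hf ⊢
        intro m hm
        -- Multiplication by `X i` leaves the exponents at indices of `T` unchanged, as `i ∉ T`.
        obtain ⟨j, hj, hne⟩ := hf (Finsupp.single i 1 + m) (by
          rw [MvPolynomial.mem_support_iff, MvPolynomial.coeff_X_mul]
          exact MvPolynomial.mem_support_iff.mp hm)
        refine ⟨j, hj, ?_⟩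
        have : i ≠ j := by rintro rfl; exact hi hj
        simpa [this] using hne
  rw [key Finset.univ, Finset.card_univ, Nat.card_eq_fintype_card]
  exact le_add_self

end Quotient

/-! ### Ideals in disjoint variables and tensor products over the field. -/

section Tensor

open TensorProduct

variable {σ τ : Type} {k : Type u} [Field k]

lemma TensorProduct.tmul_ne_zero_of_ne_zero {V W : Type*} [AddCommGroup V] [AddCommGroup W]
    [Module k V] [Module k W] {v : V} {w : W} (hv : v ≠ 0) (hw : w ≠ 0) :
    v ⊗ₜ[k] w ≠ 0 := by
  intro h
  obtain ⟨φ, hφ⟩ : ∃ φ : Module.Dual k V, φ v ≠ 0 := by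
    by_contra! hc; exact hv ((Module.forall_dual_apply_eq_zero_iff k v).mp hc)
  obtain ⟨ψ, hψ⟩ : ∃ ψ : Module.Dual k W, ψ w ≠ 0 := by
    by_contra! hc; exact hw ((Module.forall_dual_apply_eq_zero_iff k w).mp hc)
  have := congrArg (fun t => TensorProduct.lid k k (TensorProduct.map φ ψ t)) h
  simp [hφ, hψ] at this

/-- Exhibits the multiplication as a base-changed linear map, so that flatness applies to it. -/
lemma TensorProduct.tmul_one_mul {A B : Type*} [CommRing A] [CommRing B] [Algebra k A]
    [Algebra k B] (a : A) (t : A ⊗[k] B) :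
    (a ⊗ₜ[k] (1 : B)) * t = (LinearMap.mulLeft k a).rTensor B t := by
  induction t with
  | zero => simp
  | tmul x y => simp
  | add x y hx hy => rw [mul_add, hx, hy, map_add]

lemma TensorProduct.one_tmul_mul {A B : Type*} [CommRing A] [CommRing B] [Algebra k A]
    [Algebra k B] (b : B) (t : A ⊗[k] B) :
    ((1 : A) ⊗ₜ[k] b) * t = (LinearMap.mulLeft k b).lTensor A t := by
  induction t with
  | zero => simp
  | tmul x y => simp
  | add x y hx hy => rw [mul_add, hx, hy, map_add]

/-- The extension of an ideal of `k[σ]` to `k[σ ⊕ τ]`. -/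
noncomputable abbrev extendLeft (τ : Type) (I : Ideal (MvPolynomial σ k)) :
    Ideal (MvPolynomial (σ ⊕ τ) k) :=
  I.map (MvPolynomial.rename (R := k) (Sum.inl : σ → σ ⊕ τ))

/-- The extension of an ideal of `k[τ]` to `k[σ ⊕ τ]`. -/
noncomputable abbrev extendRight (σ : Type) (J : Ideal (MvPolynomial τ k)) :
    Ideal (MvPolynomial (σ ⊕ τ) k) :=
  J.map (MvPolynomial.rename (R := k) (Sum.inr : τ → σ ⊕ τ))

/-- The canonical map `k[σ ⊕ τ] → k[σ]/I ⊗ k[τ]/J`. -/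
noncomputable def toTensorQuotient (I : Ideal (MvPolynomial σ k)) (J : Ideal (MvPolynomial τ k)) :
    MvPolynomial (σ ⊕ τ) k →ₐ[k] (MvPolynomial σ k ⧸ I) ⊗[k] (MvPolynomial τ k ⧸ J) :=
  (Algebra.TensorProduct.map (Ideal.Quotient.mkₐ k I) (Ideal.Quotient.mkₐ k J)).comp
    (MvPolynomial.tensorEquivSum k σ τ k).symm.toAlgHom

lemma tensorEquivSum_comp_includeLeft :
    (MvPolynomial.tensorEquivSum k σ τ k).toAlgHom.comp Algebra.TensorProduct.includeLeft =
      MvPolynomial.rename Sum.inl := by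
  ext i : 1
  simp

lemma tensorEquivSum_comp_includeRight :
    (MvPolynomial.tensorEquivSum k σ τ k).toAlgHom.comp Algebra.TensorProduct.includeRight =
      MvPolynomial.rename Sum.inr := by
  ext i : 1
  simp

variable (I : Ideal (MvPolynomial σ k)) (J : Ideal (MvPolynomial τ k))

@[simp]
lemma toTensorQuotient_rename_inl (a : MvPolynomial σ k) :
    toTensorQuotient I J (MvPolynomial.rename Sum.inl a) = Ideal.Quotient.mk I a ⊗ₜ 1 := by
  rw [← tensorEquivSum_comp_includeLeft]
  simp [toTensorQuotient]

@[simp]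
lemma toTensorQuotient_rename_inr (b : MvPolynomial τ k) :
    toTensorQuotient I J (MvPolynomial.rename Sum.inr b) = 1 ⊗ₜ Ideal.Quotient.mk J b := by
  rw [← tensorEquivSum_comp_includeRight]
  simp [toTensorQuotient]

/-- The kernel of a tensor product of surjections is the sum of the extended kernels. Membership in
$I+J$ thus becomes vanishing in $A/I\otimes_k B/J$. -/
lemma toTensorQuotient_eq_zero_iff {f : MvPolynomial (σ ⊕ τ) k} :
    toTensorQuotient I J f = 0 ↔ f ∈ extendLeft τ I ⊔ extendRight σ J := by
  let e := MvPolynomial.tensorEquivSum k σ τ k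
  have hk := Algebra.TensorProduct.map_ker (Ideal.Quotient.mkₐ k I) (Ideal.Quotient.mkₐ k J)
    (Ideal.Quotient.mkₐ_surjective k I) (Ideal.Quotient.mkₐ_surjective k J)
  rw [show RingHom.ker (Ideal.Quotient.mkₐ k I) = I from Ideal.Quotient.mkₐ_ker k I,
    show RingHom.ker (Ideal.Quotient.mkₐ k J) = J from Ideal.Quotient.mkₐ_ker k J] at hk
  have h1 : toTensorQuotient I J f = 0 ↔ e.symm f ∈ RingHom.ker (Algebra.TensorProduct.map
      (Ideal.Quotient.mkₐ k I) (Ideal.Quotient.mkₐ k J)) := Iff.rfl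
  have h2 : extendLeft τ I ⊔ extendRight σ J = (I.map (Algebra.TensorProduct.includeLeft :
      MvPolynomial σ k →ₐ[k] MvPolynomial σ k ⊗[k] MvPolynomial τ k) ⊔
      J.map (Algebra.TensorProduct.includeRight :
      MvPolynomial τ k →ₐ[k] MvPolynomial σ k ⊗[k] MvPolynomial τ k)).map e.toAlgHom := by
    rw [Ideal.map_sup, Ideal.map_mapₐ, Ideal.map_mapₐ, tensorEquivSum_comp_includeLeft,
      tensorEquivSum_comp_includeRight]
  rw [h1, hk, h2]
  constructor
  · intro h
    have := Ideal.mem_map_of_mem e.toAlgHom h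
    simpa using this
  · intro h
    have := Ideal.mem_map_of_mem e.symm.toAlgHom h
    rw [Ideal.map_mapₐ] at this
    have he : e.symm.toAlgHom.comp e.toAlgHom = AlgHom.id k _ := by ext <;> simp
    rw [he] at this
    simpa using this

/-- Multiplication by `a` is injective on $A/I$, and stays so after tensoring with $B/J$, which is
flat over the field. -/
lemma regular_extendLeft {a : MvPolynomial σ k} (ha : ∀ f, a * f ∈ I → f ∈ I)
    (f : MvPolynomial (σ ⊕ τ) k)
    (h : MvPolynomial.rename Sum.inl a * f ∈ extendLeft τ I ⊔ extendRight σ J) :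
    f ∈ extendLeft τ I ⊔ extendRight σ J := by
  rw [← toTensorQuotient_eq_zero_iff] at h ⊢
  rw [map_mul, toTensorQuotient_rename_inl] at h
  let φ : (MvPolynomial σ k ⧸ I) →ₗ[k] (MvPolynomial σ k ⧸ I) :=
    LinearMap.mulLeft k (Ideal.Quotient.mk I a)
  have hφ : Function.Injective φ := by
    rw [← LinearMap.ker_eq_bot, LinearMap.ker_eq_bot']
    intro x hx
    obtain ⟨x, rfl⟩ := Ideal.Quotient.mk_surjective x
    rw [LinearMap.mulLeft_apply, ← map_mul, Ideal.Quotient.eq_zero_iff_mem] at hx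
    exact Ideal.Quotient.eq_zero_iff_mem.mpr (ha x hx)
  have hinj := Module.Flat.rTensor_preserves_injective_linearMap
    (M := MvPolynomial τ k ⧸ J) φ hφ
  rw [TensorProduct.tmul_one_mul] at h
  exact hinj (by rw [h, map_zero])

lemma regular_extendRight {b : MvPolynomial τ k} (hb : ∀ f, b * f ∈ J → f ∈ J)
    (f : MvPolynomial (σ ⊕ τ) k)
    (h : MvPolynomial.rename Sum.inr b * f ∈ extendLeft τ I ⊔ extendRight σ J) :
    f ∈ extendLeft τ I ⊔ extendRight σ J := by
  rw [← toTensorQuotient_eq_zero_iff] at h ⊢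
  rw [map_mul, toTensorQuotient_rename_inr] at h
  let φ : (MvPolynomial τ k ⧸ J) →ₗ[k] (MvPolynomial τ k ⧸ J) :=
    LinearMap.mulLeft k (Ideal.Quotient.mk J b)
  have hφ : Function.Injective φ := by
    rw [← LinearMap.ker_eq_bot, LinearMap.ker_eq_bot']
    intro x hx
    obtain ⟨x, rfl⟩ := Ideal.Quotient.mk_surjective x
    rw [LinearMap.mulLeft_apply, ← map_mul, Ideal.Quotient.eq_zero_iff_mem] at hx
    exact Ideal.Quotient.eq_zero_iff_mem.mpr (hb x hx)
  have hinj := Module.Flat.lTensor_preserves_injective_linearMap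
    (M := MvPolynomial σ k ⧸ I) φ hφ
  rw [TensorProduct.one_tmul_mul] at h
  exact hinj (by rw [h, map_zero])

variable {I J}

lemma rename_mem_idealOfVars (e : σ → τ) {a : MvPolynomial σ k}
    (ha : a ∈ MvPolynomial.idealOfVars σ k) :
    MvPolynomial.rename e a ∈ MvPolynomial.idealOfVars τ k := by
  have : MvPolynomial.idealOfVars σ k ≤
      (MvPolynomial.idealOfVars τ k).comap (MvPolynomial.rename e) := by
    rw [MvPolynomial.idealOfVars, Ideal.span_le]
    rintro _ ⟨i, rfl⟩
    simpa using (Ideal.subset_span ⟨e i, rfl⟩ :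
      MvPolynomial.X (e i) ∈ MvPolynomial.idealOfVars τ k)
  exact this ha

lemma extendLeft_le_idealOfVars (hI : I ≤ MvPolynomial.idealOfVars σ k) :
    extendLeft τ I ≤ MvPolynomial.idealOfVars (σ ⊕ τ) k :=
  Ideal.map_le_iff_le_comap.mpr fun _ ha => rename_mem_idealOfVars _ (hI ha)

lemma extendRight_le_idealOfVars (hJ : J ≤ MvPolynomial.idealOfVars τ k) :
    extendRight σ J ≤ MvPolynomial.idealOfVars (σ ⊕ τ) k :=
  Ideal.map_le_iff_le_comap.mpr fun _ ha => rename_mem_idealOfVars _ (hJ ha)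

lemma extend_sup_span_left (a : MvPolynomial σ k) :
    extendLeft τ (I ⊔ Ideal.span {a}) ⊔ extendRight σ J =
      (extendLeft τ I ⊔ extendRight σ J) ⊔ Ideal.span {MvPolynomial.rename Sum.inl a} := by
  rw [extendLeft, Ideal.map_sup, Ideal.map_span, Set.image_singleton, sup_right_comm]

lemma extend_sup_span_right (b : MvPolynomial τ k) :
    extendLeft τ I ⊔ extendRight σ (J ⊔ Ideal.span {b}) =
      (extendLeft τ I ⊔ extendRight σ J) ⊔ Ideal.span {MvPolynomial.rename Sum.inr b} := by
  rw [extendRight, Ideal.map_sup, Ideal.map_span, Set.image_singleton, sup_assoc]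

/-- Depth is superadditive for tensor products over the base field. -/
lemma le_polyDepth_extend [Finite σ] [Finite τ] (hI : I ≤ MvPolynomial.idealOfVars σ k)
    (hJ : J ≤ MvPolynomial.idealOfVars τ k) {a b : ℕ}
    (ha : (a : ℕ∞) ≤ polyDepth σ k (MvPolynomial σ k ⧸ I))
    (hb : (b : ℕ∞) ≤ polyDepth τ k (MvPolynomial τ k ⧸ J)) :
    ((a + b : ℕ) : ℕ∞) ≤ polyDepth (σ ⊕ τ) k
      (MvPolynomial (σ ⊕ τ) k ⧸ (extendLeft τ I ⊔ extendRight σ J)) := by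
  have hle : extendLeft τ I ⊔ extendRight σ J ≤ MvPolynomial.idealOfVars (σ ⊕ τ) k :=
    sup_le (extendLeft_le_idealOfVars hI) (extendRight_le_idealOfVars hJ)
  -- Regular elements are killed one at a time, first those for `I`, then those for `J`; each stays
  -- regular on the tensor product.
  induction a generalizing I with
  | zero =>
    induction b generalizing J with
    | zero => simp
    | succ b ih =>
      obtain ⟨x, hx, hreg⟩ := exists_regular_of_polyDepth_ne_zero
        (L := J) (by rintro h; rw [h] at hb; simp at hb)
      have hJ' := sup_le hJ ((Ideal.span_singleton_le_iff_mem _).mpr hx)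
      rw [polyDepth_quotient_sup_span_singleton hJ hx hreg, Nat.cast_succ,
        ENat.add_le_add_iff_right ENat.one_ne_top] at hb
      have := ih hJ' hb (sup_le (extendLeft_le_idealOfVars hI) (extendRight_le_idealOfVars hJ'))
      rw [polyDepth_quotient_sup_span_singleton hle (rename_mem_idealOfVars Sum.inr hx)
        (regular_extendRight I J hreg), ← extend_sup_span_right, ← add_assoc, Nat.cast_succ]
      gcongr
  | succ a ih =>
    obtain ⟨x, hx, hreg⟩ := exists_regular_of_polyDepth_ne_zero
      (L := I) (by rintro h; rw [h] at ha; simp at ha)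
    have hI' := sup_le hI ((Ideal.span_singleton_le_iff_mem _).mpr hx)
    rw [polyDepth_quotient_sup_span_singleton hI hx hreg, Nat.cast_succ,
      ENat.add_le_add_iff_right ENat.one_ne_top] at ha
    have := ih hI' ha (sup_le (extendLeft_le_idealOfVars hI') (extendRight_le_idealOfVars hJ))
    rw [polyDepth_quotient_sup_span_singleton hle (rename_mem_idealOfVars Sum.inl hx)
      (regular_extendLeft I J hreg), ← extend_sup_span_left, add_right_comm, Nat.cast_succ]
    gcongr

/-- Depth is additive for tensor products over the base field. -/
lemma polyDepth_extend [Finite σ] [Finite τ] (hI : I ≤ MvPolynomial.idealOfVars σ k)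
    (hJ : J ≤ MvPolynomial.idealOfVars τ k) {a b : ℕ}
    (ha : polyDepth σ k (MvPolynomial σ k ⧸ I) = a)
    (hb : polyDepth τ k (MvPolynomial τ k ⧸ J) = b) :
    polyDepth (σ ⊕ τ) k (MvPolynomial (σ ⊕ τ) k ⧸ (extendLeft τ I ⊔ extendRight σ J)) =
      (a + b : ℕ) := by
  have hle : extendLeft τ I ⊔ extendRight σ J ≤ MvPolynomial.idealOfVars (σ ⊕ τ) k :=
    sup_le (extendLeft_le_idealOfVars hI) (extendRight_le_idealOfVars hJ)
  induction a generalizing I with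
  | zero =>
    induction b generalizing J with
    | zero =>
      -- When both depths vanish, the product of two socle elements is a socle element of the tensor
      -- product, nonzero because the base is a field.
      obtain ⟨f, hf, hf'⟩ := exists_socle_of_polyDepth_eq_zero hI ha
      obtain ⟨g, hg, hg'⟩ := exists_socle_of_polyDepth_eq_zero hJ hb
      refine polyDepth_quotient_eq_zero_of_socle
        (f := MvPolynomial.rename Sum.inl f * MvPolynomial.rename Sum.inr g) ?_ ?_
      · rw [← toTensorQuotient_eq_zero_iff, map_mul, toTensorQuotient_rename_inl,
          toTensorQuotient_rename_inr, Algebra.TensorProduct.tmul_mul_tmul, mul_one, one_mul]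
        apply TensorProduct.tmul_ne_zero_of_ne_zero <;>
          rwa [Ne, Ideal.Quotient.eq_zero_iff_mem]
      · rintro (i | j)
        · rw [← mul_assoc]
          refine Ideal.mem_sup_left (Ideal.mul_mem_right _ _ ?_)
          have := Ideal.mem_map_of_mem (MvPolynomial.rename (R := k) (Sum.inl : σ → σ ⊕ τ)) (hf' i)
          simpa using this
        · rw [mul_left_comm]
          refine Ideal.mem_sup_right (Ideal.mul_mem_left _ _ ?_)
          have := Ideal.mem_map_of_mem (MvPolynomial.rename (R := k) (Sum.inr : τ → σ ⊕ τ)) (hg' j)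
          simpa using this
    | succ b ih =>
      obtain ⟨x, hx, hreg⟩ := exists_regular_of_polyDepth_ne_zero
        (L := J) (by rintro h; rw [h] at hb; exact absurd hb.symm (by simp))
      have hJ' := sup_le hJ ((Ideal.span_singleton_le_iff_mem _).mpr hx)
      rw [polyDepth_quotient_sup_span_singleton hJ hx hreg, Nat.cast_succ,
        (ENat.add_left_injective_of_ne_top ENat.one_ne_top).eq_iff] at hb
      have := ih hJ' hb (sup_le (extendLeft_le_idealOfVars hI) (extendRight_le_idealOfVars hJ'))
      rw [polyDepth_quotient_sup_span_singleton hle (rename_mem_idealOfVars Sum.inr hx)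
        (regular_extendRight I J hreg), ← extend_sup_span_right, this, ← add_assoc, Nat.cast_succ]
  | succ a ih =>
    obtain ⟨x, hx, hreg⟩ := exists_regular_of_polyDepth_ne_zero
      (L := I) (by rintro h; rw [h] at ha; exact absurd ha.symm (by simp))
    have hI' := sup_le hI ((Ideal.span_singleton_le_iff_mem _).mpr hx)
    rw [polyDepth_quotient_sup_span_singleton hI hx hreg, Nat.cast_succ,
      (ENat.add_left_injective_of_ne_top ENat.one_ne_top).eq_iff] at ha
    have := ih hI' ha (sup_le (extendLeft_le_idealOfVars hI') (extendRight_le_idealOfVars hJ))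
    rw [polyDepth_quotient_sup_span_singleton hle (rename_mem_idealOfVars Sum.inl hx)
      (regular_extendLeft I J hreg), ← extend_sup_span_left, this, add_right_comm, Nat.cast_succ]

/-- The depth modulo the intersection of two ideals extended from disjoint sets of variables. -/
lemma polyDepth_extend_inf [Finite σ] [Finite τ] (hI : I ≤ MvPolynomial.idealOfVars σ k)
    (hJ : J ≤ MvPolynomial.idealOfVars τ k) {f : MvPolynomial σ k} {g : MvPolynomial τ k}
    (hf : f ≠ 0) (hfI : f ∈ I) (hg : g ≠ 0) (hgJ : g ∈ J) :
    polyDepth (σ ⊕ τ) k (MvPolynomial (σ ⊕ τ) k ⧸ (extendLeft τ I ⊓ extendRight σ J)) =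
      polyDepth σ k (MvPolynomial σ k ⧸ I) + polyDepth τ k (MvPolynomial τ k ⧸ J) + 1 := by
  obtain ⟨a, ha, ha'⟩ := exists_polyDepth_quotient_eq_lt_card hI hf hfI
  obtain ⟨b, hb, hb'⟩ := exists_polyDepth_quotient_eq_lt_card hJ hg hgJ
  -- $R/I$ is $A/I\otimes_k B/0$, so its depth is at least `a + Nat.card τ`, which exceeds `a + b`
  -- by `hb'`.
  have h1 := le_polyDepth_extend (τ := τ) hI bot_le ha.ge card_le_polyDepth_quotient_bot
  have h2 := le_polyDepth_extend (σ := σ) bot_le hJ card_le_polyDepth_quotient_bot hb.ge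
  rw [extendRight, Ideal.map_bot, sup_bot_eq] at h1
  rw [extendLeft, Ideal.map_bot, bot_sup_eq] at h2
  rw [polyDepth_quotient_inf (extendLeft_le_idealOfVars hI) (extendRight_le_idealOfVars hJ)
    (polyDepth_extend hI hJ ha hb) (le_trans (by exact_mod_cast (by omega)) h1)
    (le_trans (by exact_mod_cast (by omega)) h2), ha, hb, Nat.cast_add]

end Tensor

/-! ### Monomial ideals and elements linear in a variable. -/

section Monomial

open MvPolynomial

variable {σ τ : Type} {k : Type u} [Field k]

lemma IsMonomialIdeal.mem_iff {I : Ideal (MvPolynomial σ k)} (hI : IsMonomialIdeal I)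
    {f : MvPolynomial σ k} : f ∈ I ↔ ∀ m ∈ f.support, monomial m (1 : k) ∈ I := by
  obtain ⟨S, rfl⟩ := hI
  rw [mem_ideal_span_monomial_image]
  classical
  refine forall₂_congr fun m _ => ?_
  rw [mem_ideal_span_monomial_image, support_monomial, if_neg one_ne_zero]
  simp

lemma IsMonomialIdeal.sup {I J : Ideal (MvPolynomial σ k)} (hI : IsMonomialIdeal I)
    (hJ : IsMonomialIdeal J) : IsMonomialIdeal (I ⊔ J) := by
  obtain ⟨S, rfl⟩ := hI
  obtain ⟨T, rfl⟩ := hJ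
  exact ⟨S ∪ T, by rw [Set.image_union, Ideal.span_union]⟩

lemma IsMonomialIdeal.mul {I J : Ideal (MvPolynomial σ k)} (hI : IsMonomialIdeal I)
    (hJ : IsMonomialIdeal J) : IsMonomialIdeal (I * J) := by
  obtain ⟨S, rfl⟩ := hI
  obtain ⟨T, rfl⟩ := hJ
  refine ⟨Set.image2 (· + ·) S T, ?_⟩
  rw [Ideal.span_mul_span', ← Set.image2_mul, Set.image2_image_left, Set.image2_image_right,
    Set.image_image2]
  simp only [monomial_mul, mul_one]

lemma IsMonomialIdeal.pow {I : Ideal (MvPolynomial σ k)} (hI : IsMonomialIdeal I) (n : ℕ) :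
    IsMonomialIdeal (I ^ n) := by
  induction n with
  | zero => exact ⟨{0}, by simp [Ideal.one_eq_top]⟩
  | succ n ih => rw [pow_succ]; exact ih.mul hI

lemma IsMonomialIdeal.map_rename {I : Ideal (MvPolynomial σ k)} (hI : IsMonomialIdeal I)
    (e : σ → τ) : IsMonomialIdeal (I.map (rename (R := k) e)) := by
  obtain ⟨S, rfl⟩ := hI
  refine ⟨Finsupp.mapDomain e '' S, ?_⟩
  rw [Ideal.map_span, Set.image_image, Set.image_image]
  simp only [rename_monomial]

lemma IsMonomialIdeal.le_idealOfVars {I : Ideal (MvPolynomial σ k)} (hI : IsMonomialIdeal I)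
    (h : I ≠ ⊤) : I ≤ idealOfVars σ k := by
  intro f hf
  rw [← pow_one (idealOfVars σ k), mem_pow_idealOfVars_iff]
  intro m hm
  by_contra! h0
  have h1 := hI.mem_iff.mp hf m hm
  rw [Nat.lt_one_iff, Finsupp.degree_eq_zero_iff] at h0
  subst h0
  exact h ((Ideal.eq_top_iff_one _).mpr (by simpa using h1))

/-- In disjoint sets of variables, the intersection of monomial ideals is their product. -/
lemma IsMonomialIdeal.extend_inf_eq_mul {I : Ideal (MvPolynomial σ k)}
    {J : Ideal (MvPolynomial τ k)} (hI : IsMonomialIdeal I) (hJ : IsMonomialIdeal J) :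
    extendLeft τ I ⊓ extendRight σ J = extendLeft τ I * extendRight σ J := by
  refine le_antisymm ?_ Ideal.mul_le_inf
  rintro f ⟨h1, h2⟩
  rw [((hI.map_rename _).mul (hJ.map_rename _)).mem_iff]
  intro m hm
  obtain ⟨S, rfl⟩ := hI
  obtain ⟨T, rfl⟩ := hJ
  have g1 := h1
  have g2 := h2
  simp only [extendLeft, extendRight, Ideal.map_span, Set.image_image, rename_monomial,
    SetLike.mem_coe] at g1 g2
  rw [← Set.image_image (fun s => monomial s (1 : k)), mem_ideal_span_monomial_image] at g1 g2
  obtain ⟨_, ⟨a, ha, rfl⟩, ha'⟩ := g1 m hm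
  obtain ⟨_, ⟨b, hb, rfl⟩, hb'⟩ := g2 m hm
  -- Two monomials in disjoint variables that both divide `m` have their product dividing `m`.
  have hle : Finsupp.mapDomain Sum.inl a + Finsupp.mapDomain Sum.inr b ≤ m := by
    rintro (i | j)
    · have := ha' (Sum.inl i)
      rw [Finsupp.add_apply, Finsupp.mapDomain_of_notMem_range b (Sum.inl i) (by simp)]
      simpa using this
    · have := hb' (Sum.inr j)
      rw [Finsupp.add_apply, Finsupp.mapDomain_of_notMem_range a (Sum.inr j) (by simp)]
      simpa using this
  rw [show monomial m (1 : k) = monomial (m - (Finsupp.mapDomain Sum.inl a +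
    Finsupp.mapDomain Sum.inr b)) 1 * (rename Sum.inl (monomial a 1) *
      rename Sum.inr (monomial b 1)) by
    rw [rename_monomial, rename_monomial, monomial_mul, monomial_mul, tsub_add_cancel_of_le hle]
    simp]
  refine Ideal.mul_mem_left _ _ (Ideal.mul_mem_mul ?_ ?_)
  · exact Ideal.mem_map_of_mem _ (Ideal.subset_span ⟨a, ha, rfl⟩)
  · exact Ideal.mem_map_of_mem _ (Ideal.subset_span ⟨b, hb, rfl⟩)

lemma apply_eq_zero_of_mem_supported {c : MvPolynomial σ k} {s : Set σ} (hc : c ∈ supported k s)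
    {i : σ} (hi : i ∉ s) {m : σ →₀ ℕ} (hm : m ∈ c.support) : m i = 0 := by
  by_contra h
  exact hi (mem_supported.mp hc
    ((mem_vars_iff_mem_support i).mpr ⟨m, hm, Finsupp.mem_support_iff.mpr h⟩))

/-- If a property of monomials is stable under multiplication by monomials and under division by
`X i`, then multiplication by an element monic and linear in `X i` reflects it. -/
lemma forall_mem_support_of_X_add_mul {P : (σ →₀ ℕ) → Prop} (hadd : ∀ m t, P m → P (m + t))
    {i : σ} (hP : ∀ m, P (m + Finsupp.single i 1) → P m) {c : MvPolynomial σ k}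
    (hc : c ∈ supported k {i}ᶜ) {f : MvPolynomial σ k}
    (h : ∀ m ∈ ((X i + c) * f).support, P m) : ∀ m ∈ f.support, P m := by
  classical
  by_contra! hne
  obtain ⟨m₀, hm₀, hPm₀⟩ := hne
  -- Among the monomials of `f` violating `P`, take one of largest degree in `X i`.
  obtain ⟨m, hm, hmax⟩ := Finset.exists_max_image (f.support.filter fun m => ¬ P m)
    (fun m => m i) ⟨m₀, Finset.mem_filter.mpr ⟨hm₀, hPm₀⟩⟩
  rw [Finset.mem_filter] at hm
  obtain ⟨hm, hPm⟩ := hm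
  -- No cancellation occurs at `X i * m`: since `c` is free of `X i`, a contribution from `c * f`
  -- would come from a monomial `q` of `f` with larger `X i`-degree than `m`. Then `P q` holds by
  -- maximality, and it passes to `X i * m` and down to `m`.
  have hcf : coeff (m + Finsupp.single i 1) (c * f) = 0 := by
    rw [coeff_mul]
    refine Finset.sum_eq_zero ?_
    rintro ⟨p, q⟩ hpq
    have hpq : p + q = m + Finsupp.single i 1 := Finset.HasAntidiagonal.mem_antidiagonal.mp hpq
    dsimp only
    by_contra hne
    have hp : p ∈ c.support := mem_support_iff.mpr (left_ne_zero_of_mul hne)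
    have hq : q ∈ f.support := mem_support_iff.mpr (right_ne_zero_of_mul hne)
    have hpi := apply_eq_zero_of_mem_supported (i := i) hc (by simp) hp
    have hi := DFunLike.congr_fun hpq i
    simp only [Finsupp.add_apply, hpi, Finsupp.single_eq_same] at hi
    have hPq : P q := by
      by_contra hPq
      have := hmax q (Finset.mem_filter.mpr ⟨hq, hPq⟩)
      omega
    apply hPm
    apply hP
    rw [← hpq, add_comm]
    exact hadd _ _ hPq
  refine hPm (hP _ (h _ ?_))
  rw [mem_support_iff, add_mul, coeff_add, hcf, add_zero, add_comm m, coeff_X_mul]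
  exact mem_support_iff.mp hm

lemma IsMonomialIdeal.mem_of_X_add_mul_mem {L : Ideal (MvPolynomial σ k)}
    (hL : IsMonomialIdeal L) {i : σ} (hi : ∀ f, X i * f ∈ L → f ∈ L) {c : MvPolynomial σ k}
    (hc : c ∈ supported k {i}ᶜ) {f : MvPolynomial σ k} (h : (X i + c) * f ∈ L) : f ∈ L := by
  rw [hL.mem_iff] at h ⊢
  refine forall_mem_support_of_X_add_mul (P := fun m => monomial m (1 : k) ∈ L) ?_ ?_ hc h
  · intro m t hm
    have := L.mul_mem_right (monomial t 1) hm
    rwa [monomial_mul, one_mul] at this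
  · intro m hm
    apply hi
    rwa [X, monomial_mul, one_mul, add_comm]

/-- A sum of two variables is regular modulo a monomial ideal, if there is a regular element in an
ideal generated by these two variables and variables nilpotent modulo the ideal. -/
lemma IsMonomialIdeal.mem_of_X_add_X_add_mul_mem {L : Ideal (MvPolynomial σ k)}
    (hL : IsMonomialIdeal L) {S : Set σ} {i j : σ} (hij : i ≠ j)
    (hS : ∀ l ∈ S, l = i ∨ l = j ∨ X l ∈ L.radical) {a : MvPolynomial σ k}
    (ha : a ∈ Ideal.span (X '' S : Set (MvPolynomial σ k))) (hreg : ∀ f, a * f ∈ L → f ∈ L)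
    {c : MvPolynomial σ k} (hc : c ∈ supported k ({i, j}ᶜ : Set σ)) {f : MvPolynomial σ k}
    (h : (X i + X j + c) * f ∈ L) : f ∈ L := by
  have hc' : ∀ l ∈ ({i, j} : Set σ), c ∈ supported k ({l}ᶜ : Set σ) := fun l hl =>
    supported_mono (Set.compl_subset_compl.mpr (Set.singleton_subset_iff.mpr hl)) hc
  -- Being killed modulo `L` by some power of `X l` is stable under division by `X l`, even when `X
  -- l` is a zero divisor.
  have hpow : ∀ l : σ, ∀ c ∈ supported k ({l}ᶜ : Set σ), (X l + c) * f ∈ L → ∀ m ∈ f.support,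
      ∃ N, monomial (m + Finsupp.single l N) (1 : k) ∈ L := by
    intro l c hc h
    refine forall_mem_support_of_X_add_mul
      (P := fun m => ∃ N, monomial (m + Finsupp.single l N) (1 : k) ∈ L) ?_ ?_ hc ?_
    · rintro m t ⟨N, hN⟩
      refine ⟨N, ?_⟩
      have := L.mul_mem_right (monomial t 1) hN
      rwa [monomial_mul, one_mul, add_right_comm] at this
    · rintro m ⟨N, hN⟩
      exact ⟨1 + N, by rwa [Finsupp.single_add, ← add_assoc]⟩
    · intro m hm
      exact ⟨0, by simpa using hL.mem_iff.mp h m hm⟩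
  rw [hL.mem_iff]
  intro m hm
  -- Every variable of `S` has a power multiplying `m` into `L`; hence so does `a`, whose powers can
  -- then be cancelled.
  have hrad : Ideal.span (X '' S : Set (MvPolynomial σ k)) ≤
      (Submodule.colon L {monomial m (1 : k)}).radical := by
    have hvar : ∀ l, (∃ N, monomial (m + Finsupp.single l N) (1 : k) ∈ L) →
        X l ∈ (Submodule.colon L {monomial m (1 : k)}).radical := by
      rintro l ⟨N, hN⟩
      refine ⟨N, ?_⟩
      rwa [Submodule.mem_colon_singleton, smul_eq_mul, X_pow_eq_monomial, monomial_mul, one_mul,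
        add_comm]
    rw [Ideal.span_le]
    rintro _ ⟨l, hl, rfl⟩
    rcases hS l hl with rfl | rfl | hl
    · refine hvar l (hpow l (X j + c) (add_mem ?_ (hc' l (by simp))) ?_ m hm)
      · exact X_mem_supported.mpr (by simpa using hij.symm)
      · rwa [← add_assoc]
    · refine hvar l (hpow l (X i + c) (add_mem ?_ (hc' l (by simp))) ?_ m hm)
      · exact X_mem_supported.mpr (by simpa using hij)
      · rwa [← add_assoc, add_comm (X l)]
    · obtain ⟨N, hN⟩ := hl
      refine ⟨N, ?_⟩
      rw [Submodule.mem_colon_singleton]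
      exact L.mul_mem_right _ hN
  obtain ⟨N, hN⟩ := hrad ha
  rw [Submodule.mem_colon_singleton, smul_eq_mul] at hN
  clear hm
  induction N with
  | zero => simpa using hN
  | succ N ih => exact ih (hreg _ (by rwa [← mul_assoc, ← pow_succ']))

end Monomial

/-! ### The regular sequence `z`, `w` and the gluing along two variables. -/

section Diagonal

open MvPolynomial

variable {R : Type*} [CommRing R]

/-- Regularity of `w` after killing `z` passes to the intersection of two ideals if `z` is regular
modulo their sum. -/
lemma mem_inf_sup_span_of_mul_mem {E F : Ideal R} {z w : R}
    (hz : ∀ f, z * f ∈ E ⊔ F → f ∈ E ⊔ F)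
    (hE : ∀ f, w * f ∈ E ⊔ Ideal.span {z} → f ∈ E ⊔ Ideal.span {z})
    (hF : ∀ f, w * f ∈ F ⊔ Ideal.span {z} → f ∈ F ⊔ Ideal.span {z})
    (f : R) (h : w * f ∈ (E ⊓ F) ⊔ Ideal.span {z}) : f ∈ (E ⊓ F) ⊔ Ideal.span {z} := by
  have h1 := hE f ((sup_le_sup_right inf_le_left _ : _ ≤ E ⊔ Ideal.span {z}) h)
  have h2 := hF f ((sup_le_sup_right inf_le_right _ : _ ≤ F ⊔ Ideal.span {z}) h)
  obtain ⟨i, hi, _, hza, rfl⟩ := Submodule.mem_sup.mp h1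
  obtain ⟨a, rfl⟩ := Ideal.mem_span_singleton'.mp hza
  obtain ⟨j, hj, _, hzb, hij⟩ := Submodule.mem_sup.mp h2
  obtain ⟨b, rfl⟩ := Ideal.mem_span_singleton'.mp hzb
  -- The element is $i+az=j+bz$ with $i\in E$ and $j\in F$, so $z(a-b)=j-i$ lies in $E+F$.
  have h3 : a - b ∈ E ⊔ F := by
    apply hz
    rw [show z * (a - b) = j - i by linear_combination -hij, sub_eq_neg_add]
    exact add_mem (Ideal.mem_sup_left (neg_mem hi)) (Ideal.mem_sup_right hj)
  obtain ⟨i', hi', j', hj', hab⟩ := Submodule.mem_sup.mp h3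
  -- Splitting $a-b=i'+j'$ corrects $i$ by a multiple of $z$ to $i+zi'=j-zj'$, which lies in both
  -- ideals.
  rw [show i + a * z = (i + z * i') + (b + j') * z by linear_combination -z * hab]
  refine add_mem (Ideal.mem_sup_left ⟨add_mem hi (E.mul_mem_left _ hi'), ?_⟩)
    (Ideal.mem_sup_right (Ideal.mem_span_singleton'.mpr ⟨_, rfl⟩))
  rw [SetLike.mem_coe, show i + z * i' = j - z * j' by linear_combination z * hab - hij]
  exact sub_mem hj (F.mul_mem_left _ hj')

/-- If a retraction `ψ` eliminates `z`, then elements fixed by `ψ` which are regular modulo an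
ideal stable under `ψ` remain regular modulo `z`. -/
lemma mem_sup_span_of_mul_mem {E : Ideal R} {z w : R} (ψ : R →+* R) (hψE : ∀ e ∈ E, ψ e ∈ E)
    (hψ : ∀ f, f - ψ f ∈ Ideal.span {z}) (hψz : ψ z = 0) (hψw : ψ w = w)
    (hw : ∀ f, w * f ∈ E → f ∈ E) (f : R) (h : w * f ∈ E ⊔ Ideal.span {z}) :
    f ∈ E ⊔ Ideal.span {z} := by
  obtain ⟨i, hi, _, hza, hia⟩ := Submodule.mem_sup.mp h
  obtain ⟨a, rfl⟩ := Ideal.mem_span_singleton'.mp hza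
  have h1 : ψ f ∈ E := by
    apply hw
    have := congrArg ψ hia
    rw [map_add, map_mul, map_mul, hψz, hψw, mul_zero, add_zero] at this
    rw [← this]
    exact hψE i hi
  rw [← sub_add_cancel f (ψ f)]
  exact add_mem (Ideal.mem_sup_right (hψ f)) (Ideal.mem_sup_left h1)

variable {σ τ : Type} {k : Type u} [Field k]

/-- A substitution that moves each variable by a multiple of `z` induces the identity modulo `z`. -/
lemma sub_aeval_mem_span {ι : Type*} {z : MvPolynomial ι k} {g : ι → MvPolynomial ι k}
    (hg : ∀ i, X i - g i ∈ Ideal.span {z}) (f : MvPolynomial ι k) :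
    f - aeval g f ∈ Ideal.span {z} := by
  have : Ideal.Quotient.mkₐ k (Ideal.span {z}) =
      (Ideal.Quotient.mkₐ k (Ideal.span {z})).comp (aeval g) := by
    ext i
    simpa using Ideal.Quotient.eq.mpr (hg i)
  exact Ideal.Quotient.eq.mp (DFunLike.congr_fun this f)

variable {x₁ x₂ : σ} {y₁ y₂ : τ}

/-- The variables of the other ring are regular modulo the extension of `I`, hence so is any element
monic and linear in one of them. -/
lemma IsMonomialIdeal.mem_extendLeft_of_mul_mem {I : Ideal (MvPolynomial σ k)}
    (hI : IsMonomialIdeal I) {y : τ} {c : MvPolynomial (σ ⊕ τ) k}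
    (hc : c ∈ supported k {Sum.inr y}ᶜ) {f : MvPolynomial (σ ⊕ τ) k}
    (h : (X (Sum.inr y) + c) * f ∈ extendLeft τ I) : f ∈ extendLeft τ I := by
  refine (hI.map_rename _).mem_of_X_add_mul_mem (i := Sum.inr y) (fun f hf => ?_) hc h
  have := regular_extendRight I (⊥ : Ideal (MvPolynomial τ k)) (b := X y)
    (fun f hf => by simpa [X_ne_zero] using hf) f
  rw [extendRight, Ideal.map_bot, sup_bot_eq, rename_X] at this
  exact this hf

lemma IsMonomialIdeal.mem_extendRight_of_mul_mem {J : Ideal (MvPolynomial τ k)}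
    (hJ : IsMonomialIdeal J) {x : σ} {c : MvPolynomial (σ ⊕ τ) k}
    (hc : c ∈ supported k {Sum.inl x}ᶜ) {f : MvPolynomial (σ ⊕ τ) k}
    (h : (X (Sum.inl x) + c) * f ∈ extendRight σ J) : f ∈ extendRight σ J := by
  refine (hJ.map_rename _).mem_of_X_add_mul_mem (i := Sum.inl x) (fun f hf => ?_) hc h
  have := regular_extendLeft (⊥ : Ideal (MvPolynomial σ k)) J (a := X x)
    (fun f hf => by simpa [X_ne_zero] using hf) f
  rw [extendLeft, Ideal.map_bot, bot_sup_eq, rename_X] at this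
  exact this hf

/-- Modulo `z` the variable $y_1$ is eliminated by $y_1\mapsto x_1+x_2-y_2$. This substitution fixes
`w` and the extension of `I`, and `-w` is monic in $y_2$. -/
lemma IsMonomialIdeal.regular_diagonal_left {I : Ideal (MvPolynomial σ k)}
    (hI : IsMonomialIdeal I) (hy : y₁ ≠ y₂) {z w : MvPolynomial (σ ⊕ τ) k}
    (hz : z = X (Sum.inl x₁) + X (Sum.inl x₂) - X (Sum.inr y₁) - X (Sum.inr y₂))
    (hw : w = X (Sum.inl x₂) - X (Sum.inr y₂)) (f : MvPolynomial (σ ⊕ τ) k)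
    (h : w * f ∈ extendLeft τ I ⊔ Ideal.span {z}) : f ∈ extendLeft τ I ⊔ Ideal.span {z} := by
  classical
  let g : σ ⊕ τ → MvPolynomial (σ ⊕ τ) k := Function.update X (Sum.inr y₁)
    (X (Sum.inl x₁) + X (Sum.inl x₂) - X (Sum.inr y₂))
  have hgl : ∀ i, g (Sum.inl i) = X (Sum.inl i) := fun i =>
    Function.update_of_ne (by simp) _ _
  have hg2 : g (Sum.inr y₂) = X (Sum.inr y₂) := Function.update_of_ne (by simpa using hy.symm) _ _
  have hg1 : g (Sum.inr y₁) = X (Sum.inl x₁) + X (Sum.inl x₂) - X (Sum.inr y₂) :=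
    Function.update_self _ _ _
  refine mem_sup_span_of_mul_mem (aeval g : _ →ₐ[k] _).toRingHom ?_ (sub_aeval_mem_span ?_) ?_ ?_
    ?_ f h
  · have : (extendLeft τ I) ≤ (extendLeft τ I).comap (aeval g : _ →ₐ[k] MvPolynomial (σ ⊕ τ) k) := by
      rw [← Ideal.map_le_iff_le_comap, extendLeft, Ideal.map_mapₐ]
      apply le_of_eq
      congr 1
      ext i : 1
      simp [hgl]
    exact this
  · intro i
    by_cases hi : i = Sum.inr y₁
    · subst hi
      rw [hg1, ← Ideal.neg_mem_iff, hz]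
      convert Ideal.mem_span_singleton_self _ using 1
      ring
    · rw [show g i = X i from Function.update_of_ne hi _ _, sub_self]
      exact zero_mem _
  · simp [hz, hgl, hg1, hg2]
  · simp [hw, hgl, hg2]
  · intro f hf
    refine hI.mem_extendLeft_of_mul_mem (y := y₂) (c := -X (Sum.inl x₂))
      (neg_mem (X_mem_supported.mpr (by simp))) ?_
    rw [← Ideal.neg_mem_iff]
    convert hf using 1
    rw [hw]
    ring

/-- The mirror argument eliminates $x_1$; here `w` is monic in $x_2$. -/
lemma IsMonomialIdeal.regular_diagonal_right {J : Ideal (MvPolynomial τ k)}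
    (hJ : IsMonomialIdeal J) (hx : x₁ ≠ x₂) {z w : MvPolynomial (σ ⊕ τ) k}
    (hz : z = X (Sum.inl x₁) + X (Sum.inl x₂) - X (Sum.inr y₁) - X (Sum.inr y₂))
    (hw : w = X (Sum.inl x₂) - X (Sum.inr y₂)) (f : MvPolynomial (σ ⊕ τ) k)
    (h : w * f ∈ extendRight σ J ⊔ Ideal.span {z}) : f ∈ extendRight σ J ⊔ Ideal.span {z} := by
  classical
  let g : σ ⊕ τ → MvPolynomial (σ ⊕ τ) k := Function.update X (Sum.inl x₁)
    (X (Sum.inr y₁) + X (Sum.inr y₂) - X (Sum.inl x₂))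
  have hgr : ∀ i, g (Sum.inr i) = X (Sum.inr i) := fun i =>
    Function.update_of_ne (by simp) _ _
  have hg2 : g (Sum.inl x₂) = X (Sum.inl x₂) := Function.update_of_ne (by simpa using hx.symm) _ _
  have hg1 : g (Sum.inl x₁) = X (Sum.inr y₁) + X (Sum.inr y₂) - X (Sum.inl x₂) :=
    Function.update_self _ _ _
  refine mem_sup_span_of_mul_mem (aeval g : _ →ₐ[k] _).toRingHom ?_ (sub_aeval_mem_span ?_) ?_ ?_
    ?_ f h
  · have : (extendRight σ J) ≤
        (extendRight σ J).comap (aeval g : _ →ₐ[k] MvPolynomial (σ ⊕ τ) k) := by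
      rw [← Ideal.map_le_iff_le_comap, extendRight, Ideal.map_mapₐ]
      apply le_of_eq
      congr 1
      ext i : 1
      simp [hgr]
    exact this
  · intro i
    by_cases hi : i = Sum.inl x₁
    · subst hi
      rw [hg1, hz]
      convert Ideal.mem_span_singleton_self _ using 1
      ring
    · rw [show g i = X i from Function.update_of_ne hi _ _, sub_self]
      exact zero_mem _
  · simp [hz, hgr, hg1, hg2]
  · simp [hw, hgr, hg2]
  · intro f hf
    refine hJ.mem_extendRight_of_mul_mem (x := x₂) (c := -X (Sum.inr y₂))
      (neg_mem (X_mem_supported.mpr (by simp))) ?_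
    rwa [← sub_eq_add_neg, ← hw]

lemma rename_mem_span_X_range {ι : Type} (e : σ → ι) {a : MvPolynomial σ k}
    (ha : a ∈ idealOfVars σ k) :
    rename e a ∈ Ideal.span (X '' Set.range e : Set (MvPolynomial ι k)) := by
  have : idealOfVars σ k ≤
      (Ideal.span (X '' Set.range e : Set (MvPolynomial ι k))).comap (rename e) := by
    rw [idealOfVars, Ideal.span_le]
    rintro _ ⟨i, rfl⟩
    simpa using (Ideal.subset_span ⟨e i, ⟨i, rfl⟩, rfl⟩ :
      X (e i) ∈ Ideal.span (X '' Set.range e : Set (MvPolynomial ι k)))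
  exact this ha

lemma map_mem_radical_of_le {S : Type*} [CommRing S] (φ : R →+* S) {I : Ideal R} {L : Ideal S}
    (h : ∀ a ∈ I, φ a ∈ L) {a : R} (ha : a ∈ I.radical) : φ a ∈ L.radical := by
  obtain ⟨n, hn⟩ := ha
  exact ⟨n, by rw [← map_pow]; exact h _ hn⟩

/-- Positive depth of $A/I$ gives a regular element in $(x_1,\dots,x_r)$, and $x_3,\dots,x_r$ are
nilpotent modulo $I$; so `mem_of_X_add_X_add_mul_mem` applies to the pair $x_1,x_2$, with the
$y$-terms as remainder. If instead $B/J$ has positive depth, it applies to $y_1,y_2$ after a sign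
change. -/
lemma regular_diagonal_sup {I : Ideal (MvPolynomial σ k)} {J : Ideal (MvPolynomial τ k)}
    (hI : IsMonomialIdeal I) (hJ : IsMonomialIdeal J) (hx : x₁ ≠ x₂) (hy : y₁ ≠ y₂)
    (hIrad : ∀ i, i = x₁ ∨ i = x₂ ∨ X i ∈ I.radical)
    (hJrad : ∀ j, j = y₁ ∨ j = y₂ ∨ X j ∈ J.radical)
    (hdepth : 0 < polyDepth σ k (MvPolynomial σ k ⧸ I) ∨
      0 < polyDepth τ k (MvPolynomial τ k ⧸ J)) (f : MvPolynomial (σ ⊕ τ) k)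
    (h : (X (Sum.inl x₁) + X (Sum.inl x₂) - X (Sum.inr y₁) - X (Sum.inr y₂)) * f ∈
      extendLeft τ I ⊔ extendRight σ J) : f ∈ extendLeft τ I ⊔ extendRight σ J := by
  have hL := (hI.map_rename (Sum.inl : σ → σ ⊕ τ)).sup (hJ.map_rename (Sum.inr : τ → σ ⊕ τ))
  rcases hdepth with hd | hd
  · obtain ⟨a, ha, hreg⟩ := exists_regular_of_polyDepth_ne_zero hd.ne'
    refine hL.mem_of_X_add_X_add_mul_mem (S := Set.range Sum.inl) (i := Sum.inl x₁)
      (j := Sum.inl x₂) (c := -X (Sum.inr y₁) - X (Sum.inr y₂)) (by simpa using hx) ?_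
      (rename_mem_span_X_range _ ha) (regular_extendLeft I J hreg)
      (sub_mem (neg_mem (X_mem_supported.mpr (by simp))) (X_mem_supported.mpr (by simp))) ?_
    · rintro _ ⟨i, rfl⟩
      rcases hIrad i with rfl | rfl | hi
      · simp
      · simp
      · right; right
        have := map_mem_radical_of_le (rename (R := k) (Sum.inl : σ → σ ⊕ τ)).toRingHom
          (L := extendLeft τ I ⊔ extendRight σ J)
          (fun a ha => Ideal.mem_sup_left (Ideal.mem_map_of_mem _ ha)) hi
        simpa using this
    · convert h using 1
      ring
  · obtain ⟨b, hb, hreg⟩ := exists_regular_of_polyDepth_ne_zero hd.ne'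
    refine hL.mem_of_X_add_X_add_mul_mem (S := Set.range Sum.inr) (i := Sum.inr y₁)
      (j := Sum.inr y₂) (c := -X (Sum.inl x₁) - X (Sum.inl x₂)) (by simpa using hy) ?_
      (rename_mem_span_X_range _ hb) (regular_extendRight I J hreg)
      (sub_mem (neg_mem (X_mem_supported.mpr (by simp))) (X_mem_supported.mpr (by simp))) ?_
    · rintro _ ⟨j, rfl⟩
      rcases hJrad j with rfl | rfl | hj
      · simp
      · simp
      · right; right
        have := map_mem_radical_of_le (rename (R := k) (Sum.inr : τ → σ ⊕ τ)).toRingHom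
          (L := extendLeft τ I ⊔ extendRight σ J)
          (fun a ha => Ideal.mem_sup_right (Ideal.mem_map_of_mem _ ha)) hj
        simpa using this
    · rw [← Ideal.neg_mem_iff]
      convert h using 1
      ring

/-- The depth of the product of monomial ideals glued along two variables. -/
lemma polyDepth_diagonal [Finite σ] [Finite τ] {I : Ideal (MvPolynomial σ k)}
    {J : Ideal (MvPolynomial τ k)} (hI : IsMonomialIdeal I) (hJ : IsMonomialIdeal J)
    (hI_proper : I ≠ ⊤) (hJ_proper : J ≠ ⊤) (hx : x₁ ≠ x₂) (hy : y₁ ≠ y₂)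
    (hIrad : ∀ i, i = x₁ ∨ i = x₂ ∨ X i ∈ I.radical)
    (hJrad : ∀ j, j = y₁ ∨ j = y₂ ∨ X j ∈ J.radical)
    {f : MvPolynomial σ k} {g : MvPolynomial τ k}
    (hf : f ≠ 0) (hfI : f ∈ I) (hg : g ≠ 0) (hgJ : g ∈ J)
    (hdepth : 0 < polyDepth σ k (MvPolynomial σ k ⧸ I) ∨
      0 < polyDepth τ k (MvPolynomial τ k ⧸ J)) :
    polyDepth (σ ⊕ τ) k (MvPolynomial (σ ⊕ τ) k ⧸ (extendLeft τ I * extendRight σ J ⊔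
      Ideal.span {X (Sum.inl x₁) - X (Sum.inr y₁), X (Sum.inl x₂) - X (Sum.inr y₂)})) + 1 =
      polyDepth σ k (MvPolynomial σ k ⧸ I) + polyDepth τ k (MvPolynomial τ k ⧸ J) := by
  obtain ⟨z, hz⟩ : ∃ z : MvPolynomial (σ ⊕ τ) k,
    z = X (Sum.inl x₁) + X (Sum.inl x₂) - X (Sum.inr y₁) - X (Sum.inr y₂) := ⟨_, rfl⟩
  obtain ⟨w, hw⟩ : ∃ w : MvPolynomial (σ ⊕ τ) k, w = X (Sum.inl x₂) - X (Sum.inr y₂) := ⟨_, rfl⟩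
  have hX : ∀ i, (X i : MvPolynomial (σ ⊕ τ) k) ∈ idealOfVars (σ ⊕ τ) k :=
    fun i => Ideal.subset_span ⟨i, rfl⟩
  have hzm : z ∈ idealOfVars (σ ⊕ τ) k := by
    rw [hz]; exact sub_mem (sub_mem (add_mem (hX _) (hX _)) (hX _)) (hX _)
  have hwm : w ∈ idealOfVars (σ ⊕ τ) k := by rw [hw]; exact sub_mem (hX _) (hX _)
  have hIm := hI.le_idealOfVars hI_proper
  have hJm := hJ.le_idealOfVars hJ_proper
  have hspan : Ideal.span {X (Sum.inl x₁) - X (Sum.inr y₁), w} = Ideal.span {z} ⊔ Ideal.span {w} := by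
    rw [← Ideal.span_insert, show z = (X (Sum.inl x₁) - X (Sum.inr y₁)) + w by rw [hz, hw]; ring,
      Ideal.span_pair_add_right]
  have hle : extendLeft τ I ⊓ extendRight σ J ≤ idealOfVars (σ ⊕ τ) k :=
    inf_le_left.trans (extendLeft_le_idealOfVars hIm)
  have hle' : (extendLeft τ I ⊓ extendRight σ J) ⊔ Ideal.span {z} ≤ idealOfVars (σ ⊕ τ) k :=
    sup_le hle ((Ideal.span_singleton_le_iff_mem _).mpr hzm)
  have hzsup := regular_diagonal_sup hI hJ hx hy hIrad hJrad hdepth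
  rw [← hz] at hzsup
  -- Regularity modulo each ideal separately is enough: up to sign `z` is monic in $y_1$, and it is
  -- monic in $x_1$.
  have hzinf : ∀ f, z * f ∈ extendLeft τ I ⊓ extendRight σ J →
      f ∈ extendLeft τ I ⊓ extendRight σ J := by
    rintro f ⟨h₁, h₂⟩
    constructor
    · refine hI.mem_extendLeft_of_mul_mem (y := y₁)
        (c := X (Sum.inr y₂) - X (Sum.inl x₁) - X (Sum.inl x₂)) (sub_mem (sub_mem ?_ ?_) ?_) ?_
      · exact X_mem_supported.mpr (by simpa using hy.symm)
      · exact X_mem_supported.mpr (by simp)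
      · exact X_mem_supported.mpr (by simp)
      · rw [← Ideal.neg_mem_iff]
        convert SetLike.mem_coe.mp h₁ using 1
        rw [hz]
        ring
    · refine hJ.mem_extendRight_of_mul_mem (x := x₁)
        (c := X (Sum.inl x₂) - X (Sum.inr y₁) - X (Sum.inr y₂)) (sub_mem (sub_mem ?_ ?_) ?_) ?_
      · exact X_mem_supported.mpr (by simpa using hx.symm)
      · exact X_mem_supported.mpr (by simp)
      · exact X_mem_supported.mpr (by simp)
      · convert SetLike.mem_coe.mp h₂ using 1
        rw [hz]
        ring
  have hwreg := mem_inf_sup_span_of_mul_mem hzsup (hI.regular_diagonal_left hy hz hw)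
    (hJ.regular_diagonal_right hx hz hw)
  have h := polyDepth_extend_inf hIm hJm hf hfI hg hgJ
  -- Killing `z` and then `w` lowers $a+b+1$ by 2; one unit is cancelled and the other stays as `+
  -- 1`.
  rw [polyDepth_quotient_sup_span_singleton hle hzm hzinf,
    polyDepth_quotient_sup_span_singleton hle' hwm hwreg,
    (ENat.add_left_injective_of_ne_top ENat.one_ne_top).eq_iff] at h
  rw [← h, ← hw, hspan, ← sup_assoc, hI.extend_inf_eq_mul hJ]

end Diagonal

/-- The $-1$ is moved to the left as `+ 1`, avoiding truncated subtraction in `ℕ∞`. Indices start at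
0, so $x_1,x_2$ have indices 0 and 1. -/
theorem proposition3p5 {k : Type*} [Field k] (r s : ℕ) (hr : 3 ≤ r) (hs : 3 ≤ s)
    (I : Ideal (MvPolynomial (Fin r) k)) (J : Ideal (MvPolynomial (Fin s) k))
    (hI : IsMonomialIdeal I) (hI_proper : I ≠ ⊤)
    (hJ : IsMonomialIdeal J) (hJ_proper : J ≠ ⊤)
    (hI_rad : ∀ i : Fin r, 2 ≤ (i : ℕ) → MvPolynomial.X i ∈ I.radical)
    (hJ_rad : ∀ j : Fin s, 2 ≤ (j : ℕ) → MvPolynomial.X j ∈ J.radical)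
    (n : ℕ) (hn : 0 < n)
    (hdepth : 0 < polyDepth (Fin r) k (MvPolynomial (Fin r) k ⧸ I ^ n) ∨
      0 < polyDepth (Fin s) k (MvPolynomial (Fin s) k ⧸ J ^ n)) :
    polyDepth (Fin r ⊕ Fin s) k (MvPolynomial (Fin r ⊕ Fin s) k ⧸
        ((I.map (MvPolynomial.rename (R := k) (Sum.inl : Fin r → Fin r ⊕ Fin s)) *
            J.map (MvPolynomial.rename (R := k) (Sum.inr : Fin s → Fin r ⊕ Fin s))) ^ n ⊔
          Ideal.span
            {MvPolynomial.X (Sum.inl ⟨0, by omega⟩) - MvPolynomial.X (Sum.inr ⟨0, by omega⟩),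
             MvPolynomial.X (Sum.inl ⟨1, by omega⟩) - MvPolynomial.X (Sum.inr ⟨1, by omega⟩)})) + 1
      = polyDepth (Fin r) k (MvPolynomial (Fin r) k ⧸ I ^ n) +
        polyDepth (Fin s) k (MvPolynomial (Fin s) k ⧸ J ^ n) := by
  have hrad : ∀ {m : ℕ} (L : Ideal (MvPolynomial (Fin m) k)) (h : 3 ≤ m),
      (∀ i : Fin m, 2 ≤ (i : ℕ) → MvPolynomial.X i ∈ L.radical) → ∀ i : Fin m,
      i = ⟨0, by omega⟩ ∨ i = ⟨1, by omega⟩ ∨ MvPolynomial.X i ∈ (L ^ n).radical := by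
    intro m L h hL i
    rw [Ideal.radical_pow _ hn.ne']
    rcases lt_or_ge (i : ℕ) 2 with hi | hi
    · rw [Fin.ext_iff, Fin.ext_iff]
      dsimp only
      omega
    · exact Or.inr (Or.inr (hL i hi))
  have hne : ∀ {m : ℕ} (L : Ideal (MvPolynomial (Fin m) k)) (h : 3 ≤ m),
      (∀ i : Fin m, 2 ≤ (i : ℕ) → MvPolynomial.X i ∈ L.radical) → ∃ f, f ≠ 0 ∧ f ∈ L ^ n := by
    intro m L h hL
    -- The third variable exists because there are at least three; a power of it is a nonzero
    -- element of the ideal.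
    obtain ⟨N, hN⟩ := hL ⟨2, by omega⟩ le_rfl
    exact ⟨_, pow_ne_zero n (pow_ne_zero N (MvPolynomial.X_ne_zero _)), Ideal.pow_mem_pow hN n⟩
  obtain ⟨f, hf, hfI⟩ := hne I hr hI_rad
  obtain ⟨g, hg, hgJ⟩ := hne J hs hJ_rad
  have hproper : ∀ {m : ℕ} {L : Ideal (MvPolynomial (Fin m) k)}, L ≠ ⊤ → L ^ n ≠ ⊤ :=
    fun h => ne_top_of_le_ne_top h (Ideal.pow_le_self hn.ne')
  rw [mul_pow, ← Ideal.map_pow, ← Ideal.map_pow]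
  exact polyDepth_diagonal (hI.pow n) (hJ.pow n) (hproper hI_proper) (hproper hJ_proper)
    (by simp) (by simp) (hrad I hr hI_rad) (hrad J hs hJ_rad) hf hfI hg hgJ hdepth
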